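/- Let $(X,d)$ be a complete metric space, $u^*\in X$, and let $\phi_\varepsilon\colon X\to(-\infty,+\infty]$ ($\varepsilon>0$) and $\phi\colon X\to(-\infty,+\infty]$. The (descending) slope of $\psi\colon X\to(-\infty,+\infty]$ is $|\partial\psi|(x)=\limsup_{y\to x}\frac{(\psi(x)-\psi(y))^+}{d(x,y)}$ if $\psi(x)<+\infty$ and $x$ is not isolated, $|\partial\psi|(x)=0$ if $\psi(x)<+\infty$ and $x$ is isolated, and $|\partial\psi|(x)=+\infty$ if $\psi(x)=+\infty$. Assume: (i) $\phi_\varepsilon$ is lower semicontinuous for every $\varepsilon>0$; (ii) there exist $C^*\in\mathbb R$ and $\tau^*>0$ such that $\inf_{v\in X}\bigl\{\phi_\varepsilon(v)+\frac1{2\tau^*}d^2(v,u^*)\bigr\}\ge C^*$ for all $\varepsilon>0$; (iii) for every $C>0$ there is a compact set $K\subset X$ such that $\{u: d^2(u,u^*)\le C,\ |\phi_\varepsilon(u)|\le C\}\subset K$ for all $\varepsilon>0$; (H) for all sequences $\varepsilon_n\to0^+$ and $v_n\to v$ in $X$ with $\sup_n\{|\phi_{\varepsilon_n}(v_n)|+|\partial\phi_{\varepsilon_n}|(v_n)\}<+\infty$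 one has $\lim_n\phi_{\varepsilon_n}(v_n)=\phi(v)$ and $\liminf_n|\partial\phi_{\varepsilon_n}|(v_n)\ge|\partial\phi|(v)$. Let $u^0_{\varepsilon,\tau}\in X$ ($\varepsilon,\tau>0$) satisfy $d^2(u^0_{\varepsilon,\tau},u^*)\le S'$ and $|\phi_\varepsilon(u^0_{\varepsilon,\tau})|\le S$ for some constants $S',S<+\infty$ independent of $\varepsilon,\tau$, and let $\tau_\varepsilon>0$ be any family with $\tau_\varepsilon\to0$ as $\varepsilon\to0^+$. Let $u\colon[0,+\infty)\to X$ be any minimizing movement along $\phi_\varepsilon$ at scale $\tau_\varepsilon$ with initial data $u^0_{\varepsilon,\tau_\varepsilon}$; that is, for small $\varepsilon$ there are sequences $(u^i_\varepsilon)_{i\ge0}$ with $u_\varepsilon^0=u^0_{\varepsilon,\tau_\varepsilon}$ and $u^{i+1}_\varepsilon$ a minimizer over $v\in X$ of $\phi_\varepsilon(v)+\frac1{2\tau_\varepsilon}d^2(v,u^i_\varepsilon)$, and there is a sequence $\varepsilon_n\to0^+$ such that $\overline u_{\varepsilon_n}(t)\to u(t)$ for every $t\ge0$, where $\overline u_\varepsilon(0)=u^0_\varepsilon$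 and $\overline u_\varepsilon(t)=u_\varepsilon^{i+1}$ for $t\in(i\tau_\varepsilon,(i+1)\tau_\varepsilon]$. Then, for every $T>0$, $u$ is a curve of maximal slope for $\phi$ in $[0,T]$; that is: - $u\in AC^2([0,T];X)$, meaning that there is $A\in L^2(0,T)$ with $d(u(s),u(t))\le\int_s^tA(r)\,dr$ for all $0\le s\le t\le T$; the a.e. smallest such $A$ exists and is denoted by $|u'|$; - $r\mapsto|\partial\phi|(u(r))$ is Lebesgue measurable on $[0,T]$, and there is a non-increasing function $\varphi\colon[0,T]\to\mathbb R$ such that $\varphi(t)=\phi(u(t))$ for a.e. $t\in[0,T]$ and $$\varphi(s)-\varphi(t)\ge\frac12\int_s^t|u'|^2(r)\,dr+\frac12\int_s^t|\partial\phi|^2(u(r))\,dr\qquad\text{for all }0\le s\le t\le T.$$ -/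

import Mathlib

open Set Filter Topology MeasureTheory
open scoped ENNReal

noncomputable section

/-- Descending slope `|∂φ|(x)` of `φ : X → (-∞, +∞]`. If `x` is isolated then `𝓝[≠] x = ⊥` and the
`limsup` (taken in `[0, +∞]`) is `0`. `EReal.toENNReal` is the positive part. -/
def descendingSlope {X : Type*} [MetricSpace X] (φ : X → EReal) (x : X) : ℝ≥0∞ :=
  open Classical in
  if φ x = ⊤ then ⊤
  else limsup (fun y => (φ x - φ y).toENNReal / edist x y) (𝓝[≠] x)

/-- `w` is a discrete minimizing sequence for `φ` with time step `τ` and initial datum `w₀`: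
`w (i+1)` minimizes `v ↦ φ v + d²(v, w i) / (2τ)` over `X`. -/
def IsDiscreteScheme {X : Type*} [MetricSpace X] (φ : X → EReal) (τ : ℝ) (w₀ : X)
    (w : ℕ → X) : Prop :=
  w 0 = w₀ ∧ ∀ i : ℕ,
    IsMinOn (fun v => φ v + ((1 / (2 * τ) * dist v (w i) ^ 2 : ℝ) : EReal)) univ (w (i + 1))

/-- Piecewise-constant interpolation on `[0, +∞)`: it equals `w (i+1)` on `(iτ, (i+1)τ]`, and
`w 0` at time `0`. -/
def piecewiseConstant {X : Type*} (τ : ℝ) (w : ℕ → X) (t : ℝ) : X :=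
  w ⌈t / τ⌉₊

/-- `u` (considered on `[0, +∞)`) is a minimizing movement along `φ ε` at scale `τ ε` with initial
data `u₀ ε`: a pointwise limit, along some sequence `ε n → 0⁺`, of the piecewise-constant
interpolations of discrete minimizing sequences. -/
def IsMinimizingMovement {X : Type*} [MetricSpace X] (φ : ℝ → X → EReal) (τ : ℝ → ℝ)
    (u₀ : ℝ → X) (u : ℝ → X) : Prop :=
  ∃ w : ℝ → ℕ → X,
    (∀ᶠ ε in 𝓝[>] (0 : ℝ), IsDiscreteScheme (φ ε) (τ ε) (u₀ ε) (w ε)) ∧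
    ∃ ε : ℕ → ℝ, (∀ n, 0 < ε n) ∧ Tendsto ε atTop (𝓝 0) ∧
      ∀ t : ℝ, 0 ≤ t →
        Tendsto (fun n => piecewiseConstant (τ (ε n)) (w (ε n)) t) atTop (𝓝 (u t))

/-- `A ∈ L²(0,T)` and `d(v(s), v(t)) ≤ ∫ₛᵗ A` for all `0 ≤ s ≤ t ≤ T`. -/
def IsSpeedBound {X : Type*} [MetricSpace X] (T : ℝ) (v : ℝ → X) (A : ℝ → ℝ) : Prop :=
  MemLp A 2 (volume.restrict (Ioo 0 T)) ∧
    ∀ s t : ℝ, 0 ≤ s → s ≤ t → t ≤ T → dist (v s) (v t) ≤ ∫ r in s..t, A r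

/-- `v ∈ AC²([0,T]; X)`. -/
def IsAC2 {X : Type*} [MetricSpace X] (T : ℝ) (v : ℝ → X) : Prop :=
  ∃ A : ℝ → ℝ, IsSpeedBound T v A

/-- `m` is the metric derivative `|v'|` on `[0,T]`: the (a.e.) smallest speed bound. -/
def IsMetricDerivative {X : Type*} [MetricSpace X] (T : ℝ) (v : ℝ → X) (m : ℝ → ℝ) : Prop :=
  IsSpeedBound T v m ∧
    ∀ A : ℝ → ℝ, IsSpeedBound T v A → ∀ᵐ r ∂(volume.restrict (Ioo 0 T)), m r ≤ A r

/-- `u` is a curve of maximal slope for `φ` in `[0,T]`. The measurability of `r ↦ |∂φ|(u(r))`,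
which gives the integral its meaning, is part of the definition; the integrals are taken in
`[0, +∞]`, so that the inequality makes them finite. -/
def IsCurveOfMaximalSlope {X : Type*} [MetricSpace X] (φ : X → EReal) (T : ℝ)
    (u : ℝ → X) : Prop :=
  IsAC2 T u ∧
  AEMeasurable (fun r => descendingSlope φ (u r)) (volume.restrict (Icc 0 T)) ∧
  ∃ m : ℝ → ℝ, IsMetricDerivative T u m ∧
  ∃ E : ℝ → ℝ, AntitoneOn E (Icc 0 T) ∧
    (∀ s t : ℝ, 0 ≤ s → s ≤ t → t ≤ T →
      (1 / 2) * (∫⁻ r in Ioo s t, ENNReal.ofReal (m r ^ 2)) +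
        (1 / 2) * (∫⁻ r in Ioo s t, descendingSlope φ (u r) ^ 2) ≤
      ENNReal.ofReal (E s - E t)) ∧
    ∀ᵐ t ∂(volume.restrict (Icc 0 T)), φ (u t) = (E t : EReal)

/-- Condition (H): along `ε n → 0⁺` and `v n → v` with `|φ_{ε n}(v n)| + |∂φ_{ε n}|(v n)` bounded,
the energies converge to `φ v` and the slopes satisfy the liminf inequality. -/
def ConditionH {X : Type*} [MetricSpace X] (φε : ℝ → X → EReal) (φ : X → EReal) : Prop :=
  ∀ (ε : ℕ → ℝ) (v : ℕ → X) (v' : X), (∀ n, 0 < ε n) → Tendsto ε atTop (𝓝 0) →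
    Tendsto v atTop (𝓝 v') →
    (⨆ n, ((φε (ε n) (v n)).abs + descendingSlope (φε (ε n)) (v n))) < ⊤ →
    Tendsto (fun n => φε (ε n) (v n)) atTop (𝓝 (φ v')) ∧
      descendingSlope φ v' ≤ liminf (fun n => descendingSlope (φε (ε n)) (v n)) atTop

end

/-! The proof passes De Giorgi's discrete energy identity to the limit, as an inequality. Between
consecutive points of a scheme, insert minimizers with intermediate steps `σ`. The envelope `σ ↦ min
(φ + d²/(2σ))` decreases at rate at least `d²/(2σ²)`, and `d/σ` bounds the slope at the minimizer.
Hence between grid times twice the energy drop, minus the discrete action `∑ d²/τ`, dominates the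
integral of the squared slope along the interpolants (`exists_deGiorgi_interpolation`).

Let `E`, `V`, `F` be limits of discrete energy, action and length, and `Q` the liminf of the bounds
on the squared slopes. Fatou's lemma gives `∫ₛᵗ Q ≤ 2(E s - E t) - (V t - V s)`, so `Q` is finite
a.e. At such times a subsequence of interpolants has bounded slopes, and (H), applied to the
interpolants rather than to the scheme, yields `φ (u t) = E t` and `|∂φ|²(u t) ≤ Q t`
(`isCurveOfMaximalSlope_of_tendsto`).

The rest concerns the limit curve alone (`isCurveOfMaximalSlope_of_dissipation`). Cauchy–Schwarz
makes `F'` a speed bound with `F'² ≤ V'`, so `F'² + |∂φ|²(u) ≤ -2E'` a.e. The chain rule gives `-E'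
≤ |∂φ|(u) B` for every speed bound `B`. With `B = F'` this forces `|∂φ|(u) = F'` a.e., hence
measurability of the slope; with general `B` it gives `F' ≤ B`, so `F'` is the metric derivative. -/

/-! ### Derivatives of monotone functions. -/

theorem HasDerivAt.le_of_frequently_sub_le {f g : ℝ → ℝ} {a b t : ℝ} (hf : HasDerivAt f a t)
    (hg : HasDerivAt g b t) (h : ∃ᶠ s in 𝓝[>] t, f s - f t ≤ g s - g t) : a ≤ b := by
  have hs := ((hg.sub hf).tendsto_slope).mono_left (nhdsGT_le_nhdsNE t)
  have hfr : ∃ᶠ s in 𝓝[>] t, 0 ≤ slope (g - f) t s := by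
    refine (h.and_eventually self_mem_nhdsWithin).mono fun s hs => ?_
    have h1 : t < s := hs.2
    rw [slope_def_field]
    apply div_nonneg _ (by linarith)
    simp only [Pi.sub_apply]
    linarith [hs.1]
  linarith [ge_of_tendsto_of_frequently hs hfr]

theorem Antitone.ae_differentiableAt {f : ℝ → ℝ} (hf : Antitone f) :
    ∀ᵐ t, DifferentiableAt ℝ f t := by
  filter_upwards [hf.neg.ae_differentiableAt] with t ht
  simpa using ht.neg

theorem Monotone.integral_deriv_le {f : ℝ → ℝ} (hf : Monotone f) {s t : ℝ} (hst : s ≤ t) :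
    ∫ r in s..t, deriv f r ≤ f t - f s := by
  have h := (hf.monotoneOn (uIcc s t)).intervalIntegral_deriv_mem_uIcc
  rw [uIcc_of_le (by linarith [hf hst])] at h
  exact h.2

theorem Monotone.intervalIntegrable_deriv {f : ℝ → ℝ} (hf : Monotone f) (s t : ℝ) :
    IntervalIntegrable (deriv f) volume s t :=
  (hf.monotoneOn (uIcc s t)).intervalIntegrable_deriv

theorem Monotone.lintegral_deriv_le {f : ℝ → ℝ} (hf : Monotone f) {s t : ℝ} (hst : s ≤ t) :
    ∫⁻ r in Ioo s t, ENNReal.ofReal (deriv f r) ≤ ENNReal.ofReal (f t - f s) := by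
  have hi := hf.intervalIntegrable_deriv s t
  rw [intervalIntegrable_iff_integrableOn_Ioo_of_le hst] at hi
  rw [← ofReal_integral_eq_lintegral_ofReal hi (Eventually.of_forall fun r => hf.deriv_nonneg)]
  apply ENNReal.ofReal_le_ofReal
  rw [← integral_Ioc_eq_integral_Ioo, ← intervalIntegral.integral_of_le hst]
  exact hf.integral_deriv_le hst

theorem ae_sq_deriv_le_deriv {F V : ℝ → ℝ} (hF : Monotone F) (hV : Monotone V)
    (h : ∀ s t, s ≤ t → (F t - F s) ^ 2 ≤ (t - s) * (V t - V s)) :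
    ∀ᵐ r, deriv F r ^ 2 ≤ deriv V r := by
  filter_upwards [hF.ae_differentiableAt, hV.ae_differentiableAt] with r h1 h2
  have hF' := (h1.hasDerivAt.tendsto_slope).mono_left (nhdsGT_le_nhdsNE r)
  have hV' := (h2.hasDerivAt.tendsto_slope).mono_left (nhdsGT_le_nhdsNE r)
  refine le_of_tendsto_of_tendsto (hF'.pow 2) hV' ?_
  filter_upwards [self_mem_nhdsWithin] with s hs
  have hs : 0 < s - r := sub_pos.2 hs
  rw [slope_def_field, slope_def_field, div_pow, div_le_div_iff₀ (by positivity) hs]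
  nlinarith [h r s (by linarith)]

/-- A monotone function with increments controlled in the sense of `AC²` has no singular part. -/
theorem sub_le_integral_deriv {F V : ℝ → ℝ} (hF : Monotone F) (hV : Monotone V)
    (h : ∀ s t, s ≤ t → (F t - F s) ^ 2 ≤ (t - s) * (V t - V s)) {s t : ℝ} (hst : s ≤ t) :
    F t - F s ≤ ∫ r in s..t, deriv F r := by
  -- By Young's inequality an increment of `F` is at most that of `c V + r/(4c)`, so the difference
  -- is monotone and its derivative integrates to at most its increment. The singular part of `F` is
  -- thus at most `c` times that of `V`; let `c → 0`.
  have key : ∀ c : ℝ, 0 < c → F t - F s ≤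
      (∫ r in s..t, deriv F r) + c * ((V t - V s) - ∫ r in s..t, deriv V r) := by
    intro c hc
    have hmono : Monotone fun r => (c * V r + (4 * c)⁻¹ * r) - F r := by
      intro x y hxy
      have h1 := h x y hxy
      have hVxy := hV hxy
      have hFxy := hF hxy
      have h2 : F y - F x ≤ c * (V y - V x) + (4 * c)⁻¹ * (y - x) := by
        refine abs_le_of_sq_le_sq' ?_ ?_ |>.2
        · have : (y - x) * (V y - V x) = 4 * (c * (V y - V x)) * ((4 * c)⁻¹ * (y - x)) := by
            field_simp
          nlinarith [sq_nonneg (c * (V y - V x) - (4 * c)⁻¹ * (y - x))]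
        · have : 0 ≤ y - x := by linarith
          have : 0 ≤ V y - V x := by linarith
          positivity
      simp only
      linarith
    have h3 := hmono.integral_deriv_le hst
    have h4 : ∫ r in s..t, deriv (fun r => (c * V r + (4 * c)⁻¹ * r) - F r) r =
        ∫ r in s..t, ((c * deriv V r + (4 * c)⁻¹) - deriv F r) := by
      apply intervalIntegral.integral_congr_ae
      filter_upwards [hF.ae_differentiableAt, hV.ae_differentiableAt] with r h1 h2 _
      have := (((h2.hasDerivAt.const_mul c).add ((hasDerivAt_id r).const_mul (4 * c)⁻¹)).sub
        h1.hasDerivAt).deriv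
      rw [mul_one] at this
      exact this
    have iF := hF.intervalIntegrable_deriv s t
    have iV := hV.intervalIntegrable_deriv s t
    rw [h4, intervalIntegral.integral_sub ((iV.const_mul c).add (by simp)) iF,
      intervalIntegral.integral_add (iV.const_mul c) (by simp),
      intervalIntegral.integral_const_mul, intervalIntegral.integral_const] at h3
    simp only [smul_eq_mul] at h3
    linarith
  have hlim : Tendsto (fun c : ℝ => (∫ r in s..t, deriv F r) +
      c * ((V t - V s) - ∫ r in s..t, deriv V r)) (𝓝[>] 0) (𝓝 (∫ r in s..t, deriv F r)) := by
    have : Continuous (fun c : ℝ => (∫ r in s..t, deriv F r) +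
      c * ((V t - V s) - ∫ r in s..t, deriv V r)) := by fun_prop
    have := (this.tendsto 0).mono_left (nhdsWithin_le_nhds (s := Ioi 0))
    simpa using this
  refine ge_of_tendsto hlim ?_
  filter_upwards [self_mem_nhdsWithin] with c hc
  exact key c hc

/-- Lebesgue differentiation: the primitive of `Q` grows no faster than `f`, so a.e. its derivative
`Q` is at most `f'`. Jumps and singular parts of `f` do no harm. -/
theorem ae_le_deriv_of_lintegral_le {f : ℝ → ℝ} (hf : Monotone f) {Q : ℝ → ℝ≥0∞}
    (hQ : Measurable Q) {T : ℝ} (hT : 0 < T)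
    (h : ∀ s t, 0 ≤ s → s ≤ t → t ≤ T → ∫⁻ r in Ioo s t, Q r ≤ ENNReal.ofReal (f t - f s)) :
    ∀ᵐ t ∂(volume.restrict (Ioo 0 T)), Q t ≤ ENNReal.ofReal (deriv f t) := by
  have hfin : ∫⁻ r in Ioo 0 T, Q r ≠ ⊤ :=
    ((h 0 T le_rfl hT.le le_rfl).trans_lt ENNReal.ofReal_lt_top).ne
  have hlt := ae_lt_top hQ hfin
  have hint : IntegrableOn (fun r => (Q r).toReal) (Ioo 0 T) :=
    integrable_toReal_of_lintegral_ne_top hQ.aemeasurable hfin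
  have hii : IntervalIntegrable (fun r => (Q r).toReal) volume 0 T := by
    rwa [intervalIntegrable_iff_integrableOn_Ioo_of_le hT.le]
  filter_upwards [hlt, ae_restrict_mem measurableSet_Ioo,
    ae_restrict_of_ae hf.ae_differentiableAt,
    ae_restrict_of_ae hii.ae_hasDerivAt_integral] with t h1 h2 h3 h4
  have h5 := h4 (by rw [uIcc_of_le hT.le]; exact Ioo_subset_Icc_self h2) 0 (by simp)
  rw [ENNReal.le_ofReal_iff_toReal_le h1.ne hf.deriv_nonneg]
  refine h5.le_of_frequently_sub_le h3.hasDerivAt (Eventually.frequently ?_)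
  filter_upwards [Ioo_mem_nhdsGT h2.2] with s hs
  have hts : t ≤ s := hs.1.le
  have hi1 : IntervalIntegrable (fun r => (Q r).toReal) volume 0 s :=
    hii.mono_set (uIcc_subset_uIcc_left (by
      rw [uIcc_of_le hT.le]; exact ⟨h2.1.le.trans hts, hs.2.le⟩))
  have hi2 : IntervalIntegrable (fun r => (Q r).toReal) volume 0 t :=
    hii.mono_set (uIcc_subset_uIcc_left (by
      rw [uIcc_of_le hT.le]; exact ⟨h2.1.le, h2.2.le⟩))
  rw [intervalIntegral.integral_interval_sub_left hi1 hi2, intervalIntegral.integral_of_le hts,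
    integral_Ioc_eq_integral_Ioo, integral_toReal hQ.aemeasurable]
  · exact ENNReal.toReal_le_of_le_ofReal (by linarith [hf hts]) (h t s h2.1.le hts hs.2.le)
  · exact ae_restrict_of_ae_restrict_of_subset (Ioo_subset_Ioo h2.1.le hs.2.le) hlt

/-! ### Chain rule and the energy–dissipation inequality on the limit curve. -/

section
variable {X : Type*} [MetricSpace X]

/-- Upper bound of the energy decrement by slope times increment, near a point. -/
theorem eventually_sub_le_of_descendingSlope_lt {φ : X → EReal} {x : X} {c : ℝ}
    (h : descendingSlope φ x < ENNReal.ofReal c) :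
    ∀ᶠ y in 𝓝 x, (φ x - φ y).toENNReal ≤ ENNReal.ofReal c * edist x y := by
  have hx : φ x ≠ ⊤ := by
    intro h'
    simp [descendingSlope, h'] at h
  rw [descendingSlope, if_neg hx] at h
  have h1 := eventually_lt_of_limsup_lt h
  rw [eventually_nhdsWithin_iff] at h1
  filter_upwards [h1] with y hy
  by_cases hxy : y = x
  · subst hxy
    have : φ y - φ y ≤ 0 := EReal.sub_self_le_zero
    simp [EReal.toENNReal_of_nonpos this]
  · have := hy hxy
    rw [ENNReal.div_lt_iff (Or.inl (by simpa [edist_eq_zero] using Ne.symm hxy))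
      (Or.inl (edist_ne_top _ _))] at this
    exact this.le

/-- Chain rule inequality: the dissipation rate is at most slope times speed. -/
theorem neg_deriv_le_slope_mul {φ : X → EReal} {u : ℝ → X} {E I : ℝ → ℝ} {e b t : ℝ}
    (hE : HasDerivAt E e t) (hI : HasDerivAt I b t) (hφt : φ (u t) = (E t : EReal))
    (hφ : ∃ᶠ s in 𝓝[>] t, φ (u s) = (E s : EReal))
    (hd : ∀ᶠ s in 𝓝[>] t, dist (u t) (u s) ≤ I s - I t)
    (hfin : descendingSlope φ (u t) ≠ ⊤) :
    -e ≤ (descendingSlope φ (u t)).toReal * b := by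
  have hu : Tendsto u (𝓝[>] t) (𝓝 (u t)) := by
    rw [tendsto_iff_dist_tendsto_zero]
    have h1 : Tendsto (fun s => I s - I t) (𝓝[>] t) (𝓝 0) := by
      have := (hI.continuousAt.tendsto.mono_left (nhdsWithin_le_nhds (s := Ioi t))).sub_const (I t)
      simpa using this
    refine squeeze_zero' (Eventually.of_forall fun _ => dist_nonneg) ?_ h1
    filter_upwards [hd] with s hs
    rwa [dist_comm]
  have key : ∀ c : ℝ, (descendingSlope φ (u t)).toReal < c → -e ≤ c * b := by
    intro c hc
    have hc0 : 0 ≤ c := ENNReal.toReal_nonneg.trans hc.le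
    have h1 := hu.eventually (eventually_sub_le_of_descendingSlope_lt
      ((ENNReal.lt_ofReal_iff_toReal_lt hfin).2 hc))
    refine hE.neg.le_of_frequently_sub_le (hI.const_mul c)
      ((hφ.and_eventually (h1.and hd)).mono ?_)
    rintro s ⟨h2, h3, h4⟩
    rw [hφt, h2, ← EReal.coe_sub, EReal.toENNReal_of_ne_top (EReal.coe_ne_top _),
      EReal.toReal_coe, edist_dist, ← ENNReal.ofReal_mul hc0,
      ENNReal.ofReal_le_ofReal_iff (by positivity)] at h3
    have := mul_le_mul_of_nonneg_left h4 hc0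
    simp only [Pi.neg_apply]
    linarith
  have hlim : Tendsto (fun c : ℝ => c * b) (𝓝[>] (descendingSlope φ (u t)).toReal)
      (𝓝 ((descendingSlope φ (u t)).toReal * b)) :=
    ((continuous_id.mul continuous_const).tendsto _).mono_left nhdsWithin_le_nhds
  refine ge_of_tendsto hlim ?_
  filter_upwards [self_mem_nhdsWithin] with c hc
  exact key c hc

/-- A set of full measure meets every right neighbourhood. This lets the chain rule work when `φ ∘
u` agrees with `E` only almost everywhere. -/
theorem frequently_nhdsGT_of_ae_restrict {p : ℝ → Prop} {T t : ℝ} (ht : t ∈ Ioo 0 T)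
    (h : ∀ᵐ s ∂(volume.restrict (Ioo 0 T)), p s) : ∃ᶠ s in 𝓝[>] t, p s := by
  intro hn
  obtain ⟨b, hb, hsub⟩ := (mem_nhdsGT_iff_exists_Ioo_subset).1 (inter_mem hn (Ioo_mem_nhdsGT ht.2))
  have h1 := ae_restrict_of_ae_restrict_of_subset
    (s := Ioo t b) (t := Ioo 0 T) (fun x hx => ⟨ht.1.trans hx.1, (hsub hx).2.2⟩) h
  have h2 : ∀ᵐ s ∂(volume.restrict (Ioo t b)), False := by
    filter_upwards [h1, ae_restrict_mem measurableSet_Ioo] with s hs hs'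
    exact (hsub hs').1 hs
  have h3 : volume.restrict (Ioo t b) = 0 := ae_eq_bot.1 (eventually_false_iff_eq_bot.1 h2)
  rw [Measure.restrict_eq_zero, Real.volume_Ioo, ENNReal.ofReal_eq_zero] at h3
  have : t < b := hb
  linarith

/-- Almost everywhere, the dissipation rate is at most the slope times any speed bound, which is
itself nonnegative. -/
theorem IsSpeedBound.ae_neg_deriv_le {φ : X → EReal} {u : ℝ → X} {T : ℝ} (hT : 0 < T)
    {B E : ℝ → ℝ} (hB : IsSpeedBound T u B) (hE : Antitone E)
    (hφ : ∀ᵐ t ∂(volume.restrict (Ioo 0 T)), φ (u t) = (E t : EReal)) :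
    ∀ᵐ t ∂(volume.restrict (Ioo 0 T)), 0 ≤ B t ∧ (descendingSlope φ (u t) ≠ ⊤ →
      -deriv E t ≤ (descendingSlope φ (u t)).toReal * B t) := by
  have hint : IntegrableOn B (Ioo 0 T) := hB.1.integrable (by norm_num)
  have hii : IntervalIntegrable B volume 0 T := by
    rwa [intervalIntegrable_iff_integrableOn_Ioo_of_le hT.le]
  filter_upwards [hφ, ae_restrict_mem measurableSet_Ioo, ae_restrict_of_ae hE.ae_differentiableAt,
    ae_restrict_of_ae hii.ae_hasDerivAt_integral] with t h1 h2 h3 h4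
  have h5 := h4 (by rw [uIcc_of_le hT.le]; exact Ioo_subset_Icc_self h2) 0 (by simp)
  have hd : ∀ᶠ s in 𝓝[>] t, dist (u t) (u s) ≤ (∫ r in (0 : ℝ)..s, B r) - ∫ r in (0 : ℝ)..t, B r := by
    filter_upwards [Ioo_mem_nhdsGT h2.2] with s hs
    rw [intervalIntegral.integral_interval_sub_left]
    · exact hB.2 t s h2.1.le hs.1.le hs.2.le
    · exact hii.mono_set (uIcc_subset_uIcc_left (by
        rw [uIcc_of_le hT.le]; exact ⟨h2.1.le.trans hs.1.le, hs.2.le⟩))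
    · exact hii.mono_set (uIcc_subset_uIcc_left (by
        rw [uIcc_of_le hT.le]; exact ⟨h2.1.le, h2.2.le⟩))
  refine ⟨?_, fun hfin => neg_deriv_le_slope_mul h3.hasDerivAt h5 h1
    (frequently_nhdsGT_of_ae_restrict h2 hφ) hd hfin⟩
  refine (hasDerivAt_const t (0 : ℝ)).le_of_frequently_sub_le h5 (hd.mono fun s hs => ?_).frequently
  simpa using dist_nonneg.trans hs

/-- Here `F` plays the role of length, `V` of action and `Q` of squared slope. The dissipation
inequality and the chain rule are opposite bounds, and equality in Young's inequality identifies
slope and speed. -/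
theorem isCurveOfMaximalSlope_of_dissipation {φ : X → EReal} {u : ℝ → X} {T : ℝ} (hT : 0 < T)
    {E F V : ℝ → ℝ} {Q : ℝ → ℝ≥0∞} (hE : Antitone E) (hF : Monotone F) (hV : Monotone V)
    (hQ : Measurable Q) (hFV : ∀ s t, s ≤ t → (F t - F s) ^ 2 ≤ (t - s) * (V t - V s))
    (hEV : ∀ s t, s ≤ t → V t - V s ≤ 2 * (E s - E t))
    (hd : ∀ s t, 0 ≤ s → s ≤ t → dist (u s) (u t) ≤ F t - F s)
    (hEQ : ∀ s t, 0 ≤ s → s ≤ t →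
      ∫⁻ r in Ioo s t, Q r ≤ ENNReal.ofReal (2 * (E s - E t) - (V t - V s)))
    (hφ : ∀ᵐ t ∂(volume.restrict (Ioo 0 T)), φ (u t) = (E t : EReal))
    (hs : ∀ᵐ t ∂(volume.restrict (Ioo 0 T)), descendingSlope φ (u t) ^ 2 ≤ Q t) :
    IsCurveOfMaximalSlope φ T u := by
  have hIcc : volume.restrict (Icc (0 : ℝ) T) = volume.restrict (Ioo 0 T) :=
    restrict_Ioo_eq_restrict_Icc.symm
  have hsq := ae_sq_deriv_le_deriv hF hV hFV
  have hint : ∀ s t, s ≤ t → ∫⁻ r in Ioo s t, ENNReal.ofReal (deriv F r ^ 2) ≤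
      ENNReal.ofReal (V t - V s) := fun s t hst =>
    (lintegral_mono_ae (ae_restrict_of_ae (hsq.mono fun r hr => ENNReal.ofReal_le_ofReal hr))).trans
      (hV.lintegral_deriv_le hst)
  have hA : IsSpeedBound T u (deriv F) := by
    refine ⟨(memLp_two_iff_integrable_sq (measurable_deriv F).aestronglyMeasurable).2
      ⟨((measurable_deriv F).pow_const 2).aestronglyMeasurable, ?_⟩, fun s t h0 hst _ =>
        (hd s t h0 hst).trans (sub_le_integral_deriv hF hV hFV hst)⟩
    rw [hasFiniteIntegral_iff_ofReal (Eventually.of_forall fun r => sq_nonneg _)]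
    exact (hint 0 T hT.le).trans_lt ENNReal.ofReal_lt_top
  have hmono : Monotone fun t => -(2 * E t + V t) := by
    intro x y hxy
    simp only
    linarith [hEV x y hxy]
  have hQd := ae_le_deriv_of_lintegral_le hmono hQ hT (fun s t h0 hst _ =>
    (hEQ s t h0 hst).trans (ENNReal.ofReal_le_ofReal (by linarith)))
  have hmain : ∀ᵐ t ∂(volume.restrict (Ioo 0 T)), descendingSlope φ (u t) ≠ ⊤ ∧
      deriv F t ^ 2 + (descendingSlope φ (u t)).toReal ^ 2 ≤ -(2 * deriv E t) := by
    filter_upwards [hQd, hs, ae_restrict_of_ae hsq, ae_restrict_of_ae hE.ae_differentiableAt,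
      ae_restrict_of_ae hV.ae_differentiableAt] with t h1 h2 h3 h4 h5
    have h6 : deriv (fun t => -(2 * E t + V t)) t = -(2 * deriv E t + deriv V t) :=
      (((h4.hasDerivAt.const_mul 2).add h5.hasDerivAt).neg).deriv
    have h7 := h2.trans h1
    have h8 : descendingSlope φ (u t) ≠ ⊤ := by
      intro h
      rw [h] at h7
      simp at h7
    refine ⟨h8, ?_⟩
    rw [ENNReal.le_ofReal_iff_toReal_le (by simp [h8]) hmono.deriv_nonneg, h6,
      ENNReal.toReal_pow] at h7
    linarith
  have heq : ∀ᵐ t ∂(volume.restrict (Ioo 0 T)),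
      descendingSlope φ (u t) = ENNReal.ofReal (deriv F t) ∧ deriv F t ^ 2 ≤ -deriv E t := by
    filter_upwards [hmain, hA.ae_neg_deriv_le hT hE hφ] with t h1 h2
    have h3 := h2.2 h1.1
    -- The two bounds combine to `F'² + |∂φ|² ≤ 2 |∂φ| F'`, that is, `(F' - |∂φ|)² ≤ 0`.
    have h4 : (descendingSlope φ (u t)).toReal = deriv F t := by nlinarith
    rw [h4] at h1
    exact ⟨by rw [← h4, ENNReal.ofReal_toReal h1.1], by linarith [h1.2]⟩
  refine ⟨⟨_, hA⟩, ?_, deriv F, ⟨hA, fun B hB => ?_⟩, E, hE.antitoneOn _, ?_, ?_⟩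
  · rw [hIcc]
    exact ((measurable_deriv F).ennreal_ofReal).aemeasurable.congr (heq.mono fun t ht => ht.1.symm)
  · filter_upwards [heq, hB.ae_neg_deriv_le hT hE hφ] with t h1 h2
    have h3 := h2.2 (by rw [h1.1]; exact ENNReal.ofReal_ne_top)
    have h0 : 0 ≤ deriv F t := hF.deriv_nonneg
    rw [h1.1, ENNReal.toReal_ofReal h0] at h3
    -- Now `F'² ≤ -E' ≤ F' B`. One can cancel `F'` when it is positive; otherwise `0 ≤ B` suffices.
    rcases h0.eq_or_lt with h | h
    · rw [← h]; exact h2.1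
    · nlinarith [h1.2]
  · intro s t h0 hst htT
    have h1 : ∫⁻ r in Ioo s t, descendingSlope φ (u r) ^ 2 ≤ ∫⁻ r in Ioo s t, Q r :=
      lintegral_mono_ae (ae_restrict_of_ae_restrict_of_subset (Ioo_subset_Ioo h0 htT) hs)
    rw [← mul_add]
    calc _ ≤ 1 / 2 * (ENNReal.ofReal (V t - V s) +
          ENNReal.ofReal (2 * (E s - E t) - (V t - V s))) := by
          gcongr
          · exact hint s t hst
          · exact h1.trans (hEQ s t h0 hst)
      _ = ENNReal.ofReal (E s - E t) := by
          rw [← ENNReal.ofReal_add (by linarith [hV hst]) (by linarith [hEV s t hst]),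
            show (1 / 2 : ℝ≥0∞) = ENNReal.ofReal (1 / 2) by
              rw [ENNReal.ofReal_div_of_pos (by norm_num)]; simp,
            ← ENNReal.ofReal_mul (by norm_num)]
          congr 1
          ring
  · rwa [hIcc]

end

/-! ### Proximal points and their dependence on the step. -/

section
variable {X : Type*} [MetricSpace X]

/-- `v` minimizes `x ↦ φ x + d²(x, w) / (2σ)`. -/
def IsProximal (φ : X → EReal) (σ : ℝ) (w v : X) : Prop :=
  IsMinOn (fun x => φ x + ((1 / (2 * σ) * dist x w ^ 2 : ℝ) : EReal)) univ v

namespace IsProximal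
variable {φ : X → EReal} {σ σ₁ σ₂ : ℝ} {w v v₁ v₂ : X}

theorem le_self (h : IsProximal φ σ w v) (hσ : 0 < σ) : φ v ≤ φ w := by
  have h1 := isMinOn_iff.1 h w (mem_univ w)
  simp only [dist_self, ne_eq, OfNat.ofNat_ne_zero, not_false_eq_true, zero_pow, mul_zero,
    EReal.coe_zero, add_zero] at h1
  refine le_trans ?_ h1
  exact le_add_of_nonneg_right (EReal.coe_nonneg.2 (by positivity))

theorem ne_top (h : IsProximal φ σ w v) (hσ : 0 < σ) (hw : φ w ≠ ⊤) : φ v ≠ ⊤ :=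
  ((h.le_self hσ).trans_lt (lt_top_iff_ne_top.2 hw)).ne

theorem toReal_add_le (h : IsProximal φ σ w v) (hbot : ∀ x, φ x ≠ ⊥) (hv : φ v ≠ ⊤) {y : X}
    (hy : φ y ≠ ⊤) : (φ v).toReal + 1 / (2 * σ) * dist v w ^ 2 ≤
      (φ y).toReal + 1 / (2 * σ) * dist y w ^ 2 := by
  have h1 := isMinOn_iff.1 h y (mem_univ y)
  rw [← EReal.coe_toReal hv (hbot v), ← EReal.coe_toReal hy (hbot y), ← EReal.coe_add,
    ← EReal.coe_add, EReal.coe_le_coe_iff] at h1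
  simpa using h1

theorem toReal_add_le_self (h : IsProximal φ σ w v) (hbot : ∀ x, φ x ≠ ⊥) (hσ : 0 < σ)
    (hw : φ w ≠ ⊤) : (φ v).toReal + 1 / (2 * σ) * dist v w ^ 2 ≤ (φ w).toReal := by
  simpa using h.toReal_add_le hbot (h.ne_top hσ hw) hw

/-- Adding the two minimality inequalities cancels the energies and leaves `(1/(2σ₁) - 1/(2σ₂)) (d₁²
- d₂²) ≤ 0`. -/
theorem dist_le_dist (h₁ : IsProximal φ σ₁ w v₁) (h₂ : IsProximal φ σ₂ w v₂)
    (hbot : ∀ x, φ x ≠ ⊥) (hw : φ w ≠ ⊤) (hσ : 0 < σ₁) (hlt : σ₁ < σ₂) :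
    dist v₁ w ≤ dist v₂ w := by
  have t₁ := h₁.ne_top hσ hw
  have t₂ := h₂.ne_top (hσ.trans hlt) hw
  have a := h₁.toReal_add_le hbot t₁ t₂
  have b := h₂.toReal_add_le hbot t₂ t₁
  have hlt' : 1 / (2 * σ₂) < 1 / (2 * σ₁) := by
    apply one_div_lt_one_div_of_lt <;> linarith
  refine le_of_sq_le_sq ?_ dist_nonneg
  nlinarith

theorem toReal_le_toReal (h₁ : IsProximal φ σ₁ w v₁) (h₂ : IsProximal φ σ₂ w v₂)
    (hbot : ∀ x, φ x ≠ ⊥) (hw : φ w ≠ ⊤) (hσ : 0 < σ₁) (hlt : σ₁ < σ₂) :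
    (φ v₂).toReal ≤ (φ v₁).toReal := by
  have t₁ := h₁.ne_top hσ hw
  have t₂ := h₂.ne_top (hσ.trans hlt) hw
  have b := h₂.toReal_add_le hbot t₂ t₁
  have hd := h₁.dist_le_dist h₂ hbot hw hσ hlt
  have h0 : 0 < 1 / (2 * σ₂) := by have := hσ.trans hlt; positivity
  have : 1 / (2 * σ₂) * dist v₁ w ^ 2 ≤ 1 / (2 * σ₂) * dist v₂ w ^ 2 := by gcongr
  linarith

/-- Minimality bounds the energy drop from `v` to `y` by a difference of squared distances to `w`.
Factoring it and using the triangle inequality leaves the quotient `(d(y,w) + d(v,w))/(2σ)`, which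
tends to `d(v,w)/σ` as `y → v`. -/
theorem descendingSlope_le (h : IsProximal φ σ w v) (hbot : ∀ x, φ x ≠ ⊥) (hσ : 0 < σ)
    (hw : φ w ≠ ⊤) : descendingSlope φ v ≤ ENNReal.ofReal (dist v w / σ) := by
  have hv := h.ne_top hσ hw
  rw [descendingSlope, if_neg hv]
  have hle : ∀ y, y ≠ v → (φ v - φ y).toENNReal / edist v y ≤
      ENNReal.ofReal ((dist y w + dist v w) / (2 * σ)) := by
    intro y hy
    apply ENNReal.div_le_of_le_mul
    rw [edist_dist, ← ENNReal.ofReal_mul (by positivity)]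
    by_cases hyt : φ y = ⊤
    · rw [hyt, EReal.sub_top]
      simp
    · rw [← EReal.coe_toReal hv (hbot v), ← EReal.coe_toReal hyt (hbot y), ← EReal.coe_sub,
        EReal.real_coe_toENNReal]
      apply ENNReal.ofReal_le_ofReal
      have h1 := h.toReal_add_le hbot hv hyt
      have h2 : dist y w - dist v w ≤ dist v y := by
        linarith [dist_triangle y v w, dist_comm y v]
      have h3 : (dist y w + dist v w) / (2 * σ) * dist v y =
          1 / (2 * σ) * ((dist y w + dist v w) * dist v y) := by ring
      have h4 : 1 / (2 * σ) * ((dist y w + dist v w) * (dist y w - dist v w)) ≤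
          1 / (2 * σ) * ((dist y w + dist v w) * dist v y) := by gcongr
      rw [h3]
      nlinarith
  refine le_of_forall_gt fun c hc => ?_
  have hlim : Tendsto (fun y => ENNReal.ofReal ((dist y w + dist v w) / (2 * σ))) (𝓝[≠] v)
      (𝓝 (ENNReal.ofReal (dist v w / σ))) := by
    have : Continuous fun y => ENNReal.ofReal ((dist y w + dist v w) / (2 * σ)) := by
      apply ENNReal.continuous_ofReal.comp
      fun_prop
    have := (this.tendsto v).mono_left (nhdsWithin_le_nhds (s := {v}ᶜ))
    convert this using 3
    field_simp
    ring
  obtain ⟨c', hc1, hc2⟩ := exists_between hc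
  refine (limsup_le_of_le (by isBoundedDefault) ?_).trans_lt hc2
  filter_upwards [hlim.eventually_le_const hc1, self_mem_nhdsWithin] with y h1 h2
  exact (hle y h2).trans h1

/-- The direct method. The scheme is given, but the minimizers at intermediate steps used by De
Giorgi's interpolation must be constructed. -/
theorem exists_of_coercive {uStar : X} {C τStar : ℝ} (hbot : ∀ x, φ x ≠ ⊥)
    (hlsc : LowerSemicontinuous φ) (hτ : 0 < τStar)
    (hC : ∀ v : X, (C : EReal) ≤ φ v + ((1 / (2 * τStar) * dist v uStar ^ 2 : ℝ) : EReal))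
    (hK : ∀ C > (0 : ℝ), ∃ K : Set X, IsCompact K ∧
      {u : X | dist u uStar ^ 2 ≤ C ∧ (φ u).abs ≤ ENNReal.ofReal C} ⊆ K)
    (hw : φ w ≠ ⊤) (hσ : 0 < σ) (hσ' : σ ≤ τStar / 4) : ∃ v, IsProximal φ σ w v := by
  set D := (φ w).toReal - C + dist w uStar ^ 2 / τStar with hD
  set R := 2 * (τStar * D) + 2 * dist w uStar ^ 2 with hR
  set M := |(φ w).toReal| + |C| + |R| + 1 / (2 * τStar) * |R| + 1 with hM
  obtain ⟨K, hKc, hKs⟩ := hK M (by positivity)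
  -- Competitors no worse than `w` lie in `K`. Since `σ ≤ τStar / 4`, the penalty is at least `2
  -- d²(v,w)/τStar`, whereas coercivity costs only `d²(v,w)/τStar`; the surplus bounds the distance
  -- by `D`, and then the energy.
  have hsub : ∀ v, φ v + ((1 / (2 * σ) * dist v w ^ 2 : ℝ) : EReal) ≤ φ w → v ∈ K := by
    intro v hv
    have hvt : φ v ≠ ⊤ := by
      intro h
      rw [h, EReal.top_add_coe] at hv
      exact hw (top_le_iff.1 hv)
    have h1 := hC v
    rw [← EReal.coe_toReal hvt (hbot v), ← EReal.coe_toReal hw (hbot w), ← EReal.coe_add,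
      EReal.coe_le_coe_iff] at hv
    rw [← EReal.coe_toReal hvt (hbot v), ← EReal.coe_add, EReal.coe_le_coe_iff] at h1
    have h2 : dist v uStar ^ 2 ≤ 2 * dist v w ^ 2 + 2 * dist w uStar ^ 2 := by
      have := dist_triangle v w uStar
      have := pow_le_pow_left₀ dist_nonneg this 2
      nlinarith [sq_nonneg (dist v w - dist w uStar)]
    have h3 : 1 / (2 * τStar) * dist v uStar ^ 2 ≤
        dist v w ^ 2 / τStar + dist w uStar ^ 2 / τStar := by
      calc _ ≤ 1 / (2 * τStar) * (2 * dist v w ^ 2 + 2 * dist w uStar ^ 2) := by gcongr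
        _ = _ := by field_simp
    have h4 : 2 / τStar ≤ 1 / (2 * σ) := by
      rw [div_le_div_iff₀ hτ (by positivity)]
      linarith
    have h5 : 2 / τStar * dist v w ^ 2 ≤ 1 / (2 * σ) * dist v w ^ 2 := by gcongr
    have h6 : dist v w ^ 2 / τStar ≤ D := by
      rw [hD]
      have : 2 / τStar * dist v w ^ 2 = 2 * (dist v w ^ 2 / τStar) := by ring
      linarith
    have h7 : dist v uStar ^ 2 ≤ R := by
      rw [div_le_iff₀ hτ] at h6
      rw [hR]
      linarith
    have h8 : 1 / (2 * τStar) * dist v uStar ^ 2 ≤ 1 / (2 * τStar) * |R| := by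
      gcongr
      exact h7.trans (le_abs_self R)
    have h9 : 0 ≤ 1 / (2 * τStar) * |R| := by positivity
    have h10 : 0 ≤ 1 / (2 * σ) * dist v w ^ 2 := by positivity
    refine hKs ⟨?_, ?_⟩
    · linarith [le_abs_self R, abs_nonneg (φ w).toReal, abs_nonneg C]
    · rw [← EReal.coe_toReal hvt (hbot v), EReal.abs_def]
      apply ENNReal.ofReal_le_ofReal
      rw [abs_le]
      constructor
      · linarith [neg_abs_le C, abs_nonneg (φ w).toReal, abs_nonneg R]
      · linarith [le_abs_self (φ w).toReal, abs_nonneg C, abs_nonneg R]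
  have hwK : w ∈ K := hsub w (by simp)
  have hl : LowerSemicontinuous fun x => φ x + ((1 / (2 * σ) * dist x w ^ 2 : ℝ) : EReal) := by
    refine hlsc.add' ?_ fun x => EReal.continuousAt_add (Or.inr (EReal.coe_ne_bot _))
      (Or.inl (hbot x))
    apply Continuous.lowerSemicontinuous
    apply continuous_coe_real_ereal.comp
    fun_prop
  obtain ⟨v, -, hv⟩ := (hl.lowerSemicontinuousOn K).exists_isMinOn ⟨w, hwK⟩ hKc
  refine ⟨v, isMinOn_iff.2 fun y _ => ?_⟩
  by_cases hy : y ∈ K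
  · exact isMinOn_iff.1 hv y hy
  · have h1 := isMinOn_iff.1 hv w hwK
    have h2 := lt_of_not_ge (mt (hsub y) hy)
    simp only [dist_self, ne_eq, OfNat.ofNat_ne_zero, not_false_eq_true, zero_pow, mul_zero,
      EReal.coe_zero, add_zero] at h1
    exact h1.trans h2.le

end IsProximal

/-! ### The discrete dissipation and De Giorgi's interpolation. -/

namespace IsDiscreteScheme
variable {φ : X → EReal} {τ : ℝ} {w₀ : X} {w : ℕ → X}

theorem isProximal (h : IsDiscreteScheme φ τ w₀ w) (i : ℕ) : IsProximal φ τ (w i) (w (i + 1)) :=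
  h.2 i

theorem antitone (h : IsDiscreteScheme φ τ w₀ w) (hτ : 0 < τ) : Antitone fun i => φ (w i) :=
  antitone_nat_of_succ_le fun i => (h.isProximal i).le_self hτ

theorem ne_top (h : IsDiscreteScheme φ τ w₀ w) (hτ : 0 < τ) (h₀ : φ w₀ ≠ ⊤) (i : ℕ) :
    φ (w i) ≠ ⊤ := by
  have h1 : φ (w i) ≤ φ (w 0) := h.antitone hτ (Nat.zero_le i)
  rw [h.1] at h1
  exact (h1.trans_lt (lt_top_iff_ne_top.2 h₀)).ne

theorem dissipation_antitone (h : IsDiscreteScheme φ τ w₀ w) (hτ : 0 < τ)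
    (hbot : ∀ x, φ x ≠ ⊥) (h₀ : φ w₀ ≠ ⊤) : Antitone fun k : ℕ =>
      (φ (w k)).toReal + (∑ j ∈ Finset.range k, dist (w j) (w (j + 1)) ^ 2 / τ) / 2 := by
  refine antitone_nat_of_succ_le fun k => ?_
  have h1 := (h.isProximal k).toReal_add_le_self hbot hτ (h.ne_top hτ h₀ k)
  rw [Finset.sum_range_succ, dist_comm]
  have : 1 / (2 * τ) * dist (w (k + 1)) (w k) ^ 2 = dist (w (k + 1)) (w k) ^ 2 / τ / 2 := by
    field_simp
  rw [add_div]
  linarith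

/-- De Giorgi variational interpolation: `v` interpolates the scheme, and the antitone function
`Θ` records the dissipated energy. -/
theorem exists_deGiorgi_interpolation (h : IsDiscreteScheme φ τ w₀ w) (hτ : 0 < τ)
    (hbot : ∀ x, φ x ≠ ⊥) (h₀ : φ w₀ ≠ ⊤)
    (hex : ∀ i : ℕ, ∀ σ, 0 < σ → σ < τ → ∃ v, IsProximal φ σ (w i) v) :
    ∃ (v : ℝ → X) (Θ : ℝ → ℝ), Antitone Θ ∧
      (∀ k : ℕ, Θ (k * τ) =
        (φ (w k)).toReal + (∑ j ∈ Finset.range k, dist (w j) (w (j + 1)) ^ 2 / τ) / 2) ∧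
      (∀ r, 0 < r → dist (v r) (w (⌈r / τ⌉₊ - 1)) ≤ dist (w ⌈r / τ⌉₊) (w (⌈r / τ⌉₊ - 1)) ∧
        φ (w ⌈r / τ⌉₊) ≤ φ (v r) ∧ φ (v r) ≤ φ (w (⌈r / τ⌉₊ - 1))) ∧
      ∀ᵐ r, 0 < r → descendingSlope φ (v r) ^ 2 ≤ ENNReal.ofReal (-2 * deriv Θ r) := by
  -- Minimizers need not be unique, so the one at `σ = τ` is prescribed to be `w (i + 1)`. This
  -- makes the values of `Θ` at grid times exact.
  have hJ : ∀ (i : ℕ) (σ : ℝ), ∃ v, (0 < σ → σ ≤ τ → IsProximal φ σ (w i) v) ∧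
      (σ = τ → v = w (i + 1)) := by
    intro i σ
    rcases eq_or_ne σ τ with rfl | hne
    · exact ⟨w (i + 1), fun _ _ => h.isProximal i, fun _ => rfl⟩
    · by_cases hσ : 0 < σ ∧ σ < τ
      · obtain ⟨v, hv⟩ := hex i σ hσ.1 hσ.2
        exact ⟨v, fun _ _ => hv, fun h => absurd h hne⟩
      · exact ⟨w i, fun h1 h2 => absurd ⟨h1, lt_of_le_of_ne h2 hne⟩ hσ, fun h => absurd h hne⟩
  choose J hJp hJτ using hJ
  have hnt := h.ne_top hτ h₀
  set S : ℕ → ℝ := fun k => ∑ j ∈ Finset.range k, dist (w j) (w (j + 1)) ^ 2 / τ with hS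
  set L : ℕ → ℝ := fun k => (φ (w k)).toReal + S k / 2 with hL
  have hLanti : Antitone L := h.dissipation_antitone hτ hbot h₀
  set g : ℕ → ℝ → ℝ := fun i σ =>
    (φ (J i σ)).toReal + 1 / (2 * σ) * dist (J i σ) (w i) ^ 2 with hg
  have hgle : ∀ i σ, 0 < σ → σ ≤ τ → g i σ ≤ (φ (w i)).toReal := fun i σ h1 h2 =>
    (hJp i σ h1 h2).toReal_add_le_self hbot h1 (hnt i)
  -- The minimizer at `σ₁` is tested in the problem at `σ₂`: a difference form of `g' ≤ -d²/(2σ²)`.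
  have hgdiff : ∀ i σ₁ σ₂, 0 < σ₁ → σ₁ ≤ σ₂ → σ₂ ≤ τ →
      dist (J i σ₁) (w i) ^ 2 / 2 * (1 / σ₁ - 1 / σ₂) ≤ g i σ₁ - g i σ₂ := by
    intro i σ₁ σ₂ h1 h2 h3
    have p1 := hJp i σ₁ h1 (h2.trans h3)
    have p2 := hJp i σ₂ (h1.trans_le h2) h3
    have h4 := p2.toReal_add_le hbot (p2.ne_top (h1.trans_le h2) (hnt i)) (p1.ne_top h1 (hnt i))
    have e1 : dist (J i σ₁) (w i) ^ 2 / 2 * (1 / σ₁ - 1 / σ₂) =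
      1 / (2 * σ₁) * dist (J i σ₁) (w i) ^ 2 - 1 / (2 * σ₂) * dist (J i σ₁) (w i) ^ 2 := by
      have := h1.trans_le h2
      field_simp
    rw [e1]
    simp only [hg]
    linarith
  have hganti : ∀ i σ₁ σ₂, 0 < σ₁ → σ₁ ≤ σ₂ → σ₂ ≤ τ → g i σ₂ ≤ g i σ₁ := by
    intro i σ₁ σ₂ h1 h2 h3
    have h4 := hgdiff i σ₁ σ₂ h1 h2 h3
    have h5 : 0 ≤ 1 / σ₁ - 1 / σ₂ := sub_nonneg.2 (one_div_le_one_div_of_le h1 h2)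
    have : 0 ≤ dist (J i σ₁) (w i) ^ 2 / 2 * (1 / σ₁ - 1 / σ₂) := by positivity
    linarith
  have hgτ : ∀ i, g i τ + S i / 2 = L (i + 1) := by
    intro i
    simp only [hg, hL, hS, hJτ i τ rfl, Finset.sum_range_succ]
    rw [dist_comm (w i)]
    field_simp
    ring
  -- For `r > 0` this is the `i` with `r` in `(iτ, (i+1)τ]`, so the local step `r - iτ` is positive
  -- and at most `τ`.
  set idx : ℝ → ℕ := fun r => ⌈r / τ⌉₊ - 1 with hidx
  have hidx_spec : ∀ r, 0 < r → ⌈r / τ⌉₊ = idx r + 1 ∧ 0 < r - idx r * τ ∧ r - idx r * τ ≤ τ := by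
    intro r hr
    have h1 : 0 < ⌈r / τ⌉₊ := Nat.ceil_pos.2 (by positivity)
    have h2 : ⌈r / τ⌉₊ = idx r + 1 := by simp only [hidx]; omega
    have h3 := (Nat.ceil_eq_iff (by omega)).1 h2
    simp only [Nat.add_sub_cancel] at h3
    refine ⟨h2, ?_, ?_⟩
    · have := (lt_div_iff₀ hτ).1 h3.1
      linarith
    · have := (div_le_iff₀ hτ).1 h3.2
      push_cast at this
      linarith
  set Θ : ℝ → ℝ := fun r => if r ≤ 0 then L 0 else g (idx r) (r - idx r * τ) + S (idx r) / 2
    with hΘ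
  have hΘpos : ∀ r, 0 < r → Θ r = g (idx r) (r - idx r * τ) + S (idx r) / 2 := fun r hr => by
    simp only [hΘ, if_neg (not_le.2 hr)]
  have hΘle : ∀ r, 0 < r → Θ r ≤ L (idx r) := by
    intro r hr
    obtain ⟨-, h2, h3⟩ := hidx_spec r hr
    rw [hΘpos r hr]
    simp only [hL]
    linarith [hgle (idx r) _ h2 h3]
  have hleΘ : ∀ r, 0 < r → L (idx r + 1) ≤ Θ r := by
    intro r hr
    obtain ⟨-, h2, h3⟩ := hidx_spec r hr
    rw [hΘpos r hr, ← hgτ]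
    linarith [hganti (idx r) _ τ h2 h3 le_rfl]
  have hidx_mono : Monotone idx := by
    intro x y hxy
    have : ⌈x / τ⌉₊ ≤ ⌈y / τ⌉₊ := Nat.ceil_mono (by gcongr)
    simp only [hidx]
    omega
  have hanti : Antitone Θ := by
    intro x y hxy
    rcases le_or_gt x 0 with hx | hx
    · have ex : Θ x = L 0 := by simp only [hΘ, if_pos hx]
      rw [ex]
      rcases le_or_gt y 0 with hy | hy
      · simp only [hΘ, if_pos hy, le_refl]
      · exact (hΘle y hy).trans (hLanti (Nat.zero_le _))
    · have hy := hx.trans_le hxy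
      rcases (hidx_mono hxy).eq_or_lt with he | hlt
      · obtain ⟨-, h2, h3⟩ := hidx_spec x hx
        obtain ⟨-, h4, h5⟩ := hidx_spec y hy
        rw [hΘpos x hx, hΘpos y hy, ← he]
        rw [← he] at h5
        linarith [hganti (idx x) (x - idx x * τ) (y - idx x * τ) h2 (by linarith) h5]
      · exact ((hΘle y hy).trans (hLanti hlt)).trans (hleΘ x hx)
  refine ⟨fun r => J (idx r) (r - idx r * τ), Θ, hanti, ?_, ?_, ?_⟩
  · intro k
    rcases k with _ | i
    · simp [hΘ, hL, hS]
    · have hpos : 0 < ((i + 1 : ℕ) : ℝ) * τ := by positivity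
      have hi : idx (((i + 1 : ℕ) : ℝ) * τ) = i := by
        simp only [hidx]
        rw [mul_div_cancel_right₀ _ hτ.ne', Nat.ceil_natCast]
        rfl
      rw [hΘpos _ hpos, hi, show ((i + 1 : ℕ) : ℝ) * τ - i * τ = τ by push_cast; ring, hgτ]
  · intro r hr
    obtain ⟨h1, h2, h3⟩ := hidx_spec r hr
    have hp := hJp (idx r) _ h2 h3
    have hτp := h.isProximal (idx r)
    change dist (J (idx r) (r - idx r * τ)) (w (idx r)) ≤ dist (w ⌈r / τ⌉₊) (w (idx r)) ∧
      φ (w ⌈r / τ⌉₊) ≤ φ (J (idx r) (r - idx r * τ)) ∧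
      φ (J (idx r) (r - idx r * τ)) ≤ φ (w (idx r))
    rw [h1]
    refine ⟨?_, ?_, hp.le_self h2⟩
    · rcases h3.eq_or_lt with he | hlt
      · rw [hJτ _ _ he]
      · exact hp.dist_le_dist hτp hbot (hnt _) h2 hlt
    · rcases h3.eq_or_lt with he | hlt
      · rw [hJτ _ _ he]
      · have := hp.toReal_le_toReal hτp hbot (hnt _) h2 hlt
        rw [← EReal.coe_toReal (hnt (idx r + 1)) (hbot _),
          ← EReal.coe_toReal (hp.ne_top h2 (hnt _)) (hbot _)]
        exact EReal.coe_le_coe_iff.2 this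
  -- Grid times are discarded so that times slightly after `r` still use the same base point.
  · have hgrid : ∀ᵐ r : ℝ, r ∉ range fun k : ℕ => (k : ℝ) * τ :=
      (countable_range _).ae_notMem volume
    filter_upwards [hanti.ae_differentiableAt, hgrid] with r hd hgr hr
    obtain ⟨h1, h2, h3⟩ := hidx_spec r hr
    have hlt : r - idx r * τ < τ := by
      refine lt_of_le_of_ne h3 fun he => hgr ⟨idx r + 1, ?_⟩
      push_cast
      linarith
    have hp := hJp (idx r) _ h2 h3
    set i := idx r with hi
    set σ := r - i * τ with hσ
    set d := dist (J i σ) (w i) with hd'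
    -- The comparison function freezes the distance `d` at time `r`; to the right of `r`, by
    -- `hgdiff`, its increments are at most those of `-Θ`.
    have hderiv : HasDerivAt (fun s => -(d ^ 2 / 2 * (s - i * τ)⁻¹)) (d ^ 2 / 2 / σ ^ 2) r := by
      have h4 := ((((hasDerivAt_id r).sub_const ((i : ℝ) * τ)).inv h2.ne').const_mul
        (d ^ 2 / 2)).neg
      have e : d ^ 2 / 2 / σ ^ 2 = -(d ^ 2 / 2 * (-1 / (id r - (i : ℝ) * τ) ^ 2)) := by
        rw [id, ← hσ]
        ring
      rw [e]
      exact h4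
    have hle : d ^ 2 / 2 / σ ^ 2 ≤ -deriv Θ r := by
      refine hderiv.le_of_frequently_sub_le hd.hasDerivAt.neg (Eventually.frequently ?_)
      filter_upwards [Ioo_mem_nhdsGT (show r < r + (τ - σ) by linarith)] with s hs
      have hs0 : 0 < s := hr.trans hs.1
      have his : idx s = i := by
        have h5 : ⌈s / τ⌉₊ = i + 1 := by
          rw [Nat.ceil_eq_iff (by omega), lt_div_iff₀ hτ, div_le_iff₀ hτ]
          simp only [Nat.add_sub_cancel]
          push_cast
          constructor
          · linarith [hs.1]
          · linarith [hs.2]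
        simp only [hidx, h5]
        rfl
      have h6 := hgdiff i σ (s - i * τ) h2 (by linarith [hs.1]) (by linarith [hs.2])
      simp only [Pi.neg_apply]
      rw [hΘpos s hs0, hΘpos r hr, his, ← hi, ← hσ]
      rw [one_div, one_div] at h6
      linarith
    have h7 := hp.descendingSlope_le hbot h2 (hnt i)
    calc _ ≤ ENNReal.ofReal (d / σ) ^ 2 := by gcongr
      _ = ENNReal.ofReal ((d / σ) ^ 2) := by rw [ENNReal.ofReal_pow (by positivity)]
      _ ≤ _ := by
        apply ENNReal.ofReal_le_ofReal
        have : (d / σ) ^ 2 = 2 * (d ^ 2 / 2 / σ ^ 2) := by field_simp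
        linarith

end IsDiscreteScheme
end

/-! ### Ultrafilter limits and rounding to the time grid. -/

theorem exists_tendsto_hyperfilter {f : ℕ → ℝ} {M : ℝ} (h : ∀ᶠ n in atTop, |f n| ≤ M) :
    ∃ a, Tendsto f (hyperfilter ℕ) (𝓝 a) := by
  have h1 : ∀ᶠ n in (hyperfilter ℕ : Filter ℕ), f n ∈ Icc (-M) M := by
    filter_upwards [h.filter_mono Nat.hyperfilter_le_atTop] with n hn
    exact abs_le.1 hn
  obtain ⟨a, -, ha⟩ := isCompact_iff_ultrafilter_le_nhds.1 (isCompact_Icc (a := -M) (b := M))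
    ((hyperfilter ℕ).map f) (le_principal_iff.2 h1)
  exact ⟨a, ha⟩

theorem ceil_div_mul_le {τ s : ℝ} (hτ : 0 < τ) (hs : 0 ≤ s) : (⌈s / τ⌉₊ : ℝ) * τ ≤ s + τ := by
  have h := (Nat.ceil_lt_add_one (show 0 ≤ s / τ by positivity)).le
  calc (⌈s / τ⌉₊ : ℝ) * τ ≤ (s / τ + 1) * τ := by gcongr
    _ = s + τ := by field_simp

theorem le_ceil_div_mul {τ : ℝ} (hτ : 0 < τ) (s : ℝ) : s ≤ (⌈s / τ⌉₊ : ℝ) * τ :=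
  (div_le_iff₀ hτ).1 (Nat.le_ceil _)

theorem ceil_div_mono {τ : ℝ} (hτ : 0 < τ) : Monotone fun s : ℝ => ⌈s / τ⌉₊ :=
  fun _ _ h => Nat.ceil_mono (by gcongr)

/-- Rounding up both times costs at most one extra step. Negative times are included, where `⌈·⌉₊`
is `0`, so that the limit functions can be treated on all of `ℝ`. -/
theorem ceil_div_sub_mul_le {τ s t : ℝ} (hτ : 0 < τ) (hst : s ≤ t) :
    ((⌈t / τ⌉₊ : ℝ) - ⌈s / τ⌉₊) * τ ≤ t - s + τ := by
  rcases le_or_gt 0 t with ht | ht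
  · linarith [ceil_div_mul_le hτ ht, le_ceil_div_mul hτ s]
  · have h1 : ⌈t / τ⌉₊ = 0 := Nat.ceil_eq_zero.2 (div_nonpos_of_nonpos_of_nonneg ht.le hτ.le)
    rw [h1]
    have : (0 : ℝ) ≤ ⌈s / τ⌉₊ := by positivity
    push_cast
    nlinarith

theorem sq_sum_range_sub_le {τ : ℝ} (hτ : 0 < τ) (d : ℕ → ℝ) {m n : ℕ} (hmn : m ≤ n) :
    (∑ j ∈ Finset.range n, d j - ∑ j ∈ Finset.range m, d j) ^ 2 ≤ (((n : ℝ) - m) * τ) *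
      (∑ j ∈ Finset.range n, d j ^ 2 / τ - ∑ j ∈ Finset.range m, d j ^ 2 / τ) := by
  rw [← Finset.sum_Ico_eq_sub _ hmn, ← Finset.sum_Ico_eq_sub _ hmn, ← Finset.sum_div]
  have h := sq_sum_le_card_mul_sum_sq (s := Finset.Ico m n) (f := d)
  rw [Nat.card_Ico, Nat.cast_sub hmn] at h
  refine h.trans (le_of_eq ?_)
  field_simp

/-! ### Passage to the limit in the scheme. -/

section
variable {X : Type*} [MetricSpace X]

theorem isCurveOfMaximalSlope_of_tendsto {ψ : ℕ → X → EReal} {φ : X → EReal} {τ : ℕ → ℝ}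
    {w : ℕ → ℕ → X} {w₀ : ℕ → X} {u : ℝ → X} {uStar : X} {C τStar M T : ℝ} (hT : 0 < T)
    (hbot : ∀ n x, ψ n x ≠ ⊥) (hτ : ∀ n, 0 < τ n) (hτ0 : Tendsto τ atTop (𝓝 0))
    (hsch : ∀ n, IsDiscreteScheme (ψ n) (τ n) (w₀ n) (w n))
    (hM : ∀ n, ψ n (w₀ n) ≤ (M : EReal)) (hτStar : 0 < τStar)
    (hC : ∀ n v, (C : EReal) ≤ ψ n v + ((1 / (2 * τStar) * dist v uStar ^ 2 : ℝ) : EReal))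
    (hex : ∀ n i σ, 0 < σ → σ < τ n → ∃ v, IsProximal (ψ n) σ (w n i) v)
    (hu : ∀ t, 0 ≤ t → Tendsto (fun n => piecewiseConstant (τ n) (w n) t) atTop (𝓝 (u t)))
    (hconv : ∀ q : ℚ, ∃ a : EReal,
      Tendsto (fun n => ψ n (piecewiseConstant (τ n) (w n) q)) atTop (𝓝 a))
    (hH : ∀ (k : ℕ → ℕ) (v : ℕ → X) (x : X), StrictMono k → Tendsto v atTop (𝓝 x) →
      (⨆ n, ((ψ (k n) (v n)).abs + descendingSlope (ψ (k n)) (v n))) < ⊤ →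
      Tendsto (fun n => ψ (k n) (v n)) atTop (𝓝 (φ x)) ∧
        descendingSlope φ x ≤ liminf (fun n => descendingSlope (ψ (k n)) (v n)) atTop) :
    IsCurveOfMaximalSlope φ T u := by
  have h₀ : ∀ n, ψ n (w₀ n) ≠ ⊤ := fun n => ((hM n).trans_lt (EReal.coe_lt_top M)).ne
  have hnt : ∀ n i, ψ n (w n i) ≠ ⊤ := fun n => (hsch n).ne_top (hτ n) (h₀ n)
  set N : ℕ → ℝ → ℕ := fun n t => ⌈t / τ n⌉₊ with hN
  have hNmono : ∀ n, Monotone (N n) := fun n => ceil_div_mono (hτ n)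
  set Φ : ℕ → ℕ → ℝ := fun n k => (ψ n (w n k)).toReal with hΦ
  have hΦcoe : ∀ n k, ((Φ n k : ℝ) : EReal) = ψ n (w n k) := fun n k =>
    EReal.coe_toReal (hnt n k) (hbot n _)
  have hΦanti : ∀ n, Antitone (Φ n) := by
    intro n i j hij
    rw [← EReal.coe_le_coe_iff, hΦcoe, hΦcoe]
    exact (hsch n).antitone (hτ n) hij
  have hΦM : ∀ n k, Φ n k ≤ M := by
    intro n k
    refine (hΦanti n (Nat.zero_le k)).trans ?_
    rw [← EReal.coe_le_coe_iff, hΦcoe, (hsch n).1]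
    exact hM n
  set S : ℕ → ℕ → ℝ := fun n k =>
    ∑ j ∈ Finset.range k, dist (w n j) (w n (j + 1)) ^ 2 / τ n with hS
  have hSmono : ∀ n, Monotone (S n) := by
    refine fun n => monotone_nat_of_le_succ fun k => ?_
    simp only [hS, Finset.sum_range_succ]
    have := hτ n
    exact le_add_of_nonneg_right (by positivity)
  have hS0 : ∀ n, S n 0 = 0 := fun n => by simp [hS]
  have hdiss : ∀ n, Antitone fun k => Φ n k + S n k / 2 := fun n =>
    (hsch n).dissipation_antitone (hτ n) (hbot n) (h₀ n)
  set l : ℕ → ℕ → ℝ := fun n k => ∑ j ∈ Finset.range k, dist (w n j) (w n (j + 1)) with hl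
  have hlmono : ∀ n, Monotone (l n) := by
    refine fun n => monotone_nat_of_le_succ fun k => ?_
    simp only [hl, Finset.sum_range_succ]
    exact le_add_of_nonneg_right dist_nonneg
  have hlS : ∀ n i j, i ≤ j →
      (l n j - l n i) ^ 2 ≤ (((j : ℝ) - i) * τ n) * (S n j - S n i) := fun n i j hij =>
    sq_sum_range_sub_le (hτ n) (fun j => dist (w n j) (w n (j + 1))) hij
  -- a priori bounds at a fixed time
  have hbound : ∀ t, ∃ B, ∀ᶠ n in atTop,
      |Φ n (N n t)| ≤ B ∧ |S n (N n t)| ≤ B ∧ |l n (N n t)| ≤ B := by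
    have hpos : ∀ t, 0 ≤ t → ∃ B, ∀ᶠ n in atTop,
        |Φ n (N n t)| ≤ B ∧ |S n (N n t)| ≤ B ∧ |l n (N n t)| ≤ B := by
      intro t ht
      -- Convergence at time `t` already bounds the distance to `uStar`; coercivity then bounds the
      -- energy below, and dissipation bounds the action. Cauchy–Schwarz bounds the length.
      set R := dist (u t) uStar + 1 with hR
      set m := C - 1 / (2 * τStar) * R ^ 2 with hm
      set B₁ := 2 * (M - m) with hB₁
      refine ⟨|M| + |m| + |B₁| + ((t + 1) * |B₁| + 1), ?_⟩
      have e1 : ∀ᶠ n in atTop, dist (piecewiseConstant (τ n) (w n) t) uStar ≤ R :=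
        ((hu t ht).dist tendsto_const_nhds).eventually_le_const (by linarith)
      filter_upwards [e1, hτ0.eventually_le_const zero_lt_one] with n h1 h2
      have h3 : m ≤ Φ n (N n t) := by
        have h4 := hC n (w n (N n t))
        rw [← hΦcoe, ← EReal.coe_add, EReal.coe_le_coe_iff] at h4
        have h5 : 1 / (2 * τStar) * dist (w n (N n t)) uStar ^ 2 ≤ 1 / (2 * τStar) * R ^ 2 := by
          gcongr
          exact h1
        linarith
      have h6 : S n (N n t) ≤ B₁ := by
        have h7 := hdiss n (Nat.zero_le (N n t))
        simp only [hS0] at h7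
        linarith [hΦM n 0]
      have h8 : 0 ≤ S n (N n t) := by
        rw [← hS0 n]
        exact hSmono n (Nat.zero_le _)
      have h9 : 0 ≤ l n (N n t) := by
        have := hlmono n (Nat.zero_le (N n t))
        simpa [hl] using this
      have h10 : l n (N n t) ≤ (t + 1) * |B₁| + 1 := by
        have h11 := hlS n 0 (N n t) (Nat.zero_le _)
        have h12 : l n 0 = 0 := by simp [hl]
        rw [h12, hS0, sub_zero, sub_zero, Nat.cast_zero, sub_zero] at h11
        have h13 : (N n t : ℝ) * τ n * S n (N n t) ≤ (t + 1) * |B₁| := by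
          have := (ceil_div_mul_le (hτ n) ht).trans (show t + τ n ≤ t + 1 by linarith)
          exact mul_le_mul this (h6.trans (le_abs_self _)) h8 (by linarith)
        have h14 : 0 ≤ (t + 1) * |B₁| := by positivity
        nlinarith
      have a1 := abs_nonneg M
      have a2 := abs_nonneg m
      have a3 := abs_nonneg B₁
      have a4 : 0 ≤ (t + 1) * |B₁| := by positivity
      refine ⟨abs_le.2 ⟨?_, ?_⟩, ?_, ?_⟩
      · linarith [neg_abs_le m]
      · linarith [hΦM n (N n t), le_abs_self M]
      · rw [abs_of_nonneg h8]
        linarith [le_abs_self B₁]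
      · rw [abs_of_nonneg h9]
        linarith
    intro t
    rcases le_or_gt 0 t with ht | ht
    · exact hpos t ht
    · have : ∀ n, N n t = N n 0 := fun n => by
        have h1 : N n t = 0 := Nat.ceil_eq_zero.2
          (div_nonpos_of_nonpos_of_nonneg ht.le (hτ n).le)
        rw [h1]
        simp [hN]
      simp only [this]
      exact hpos 0 le_rfl
  choose B hB using hbound
  -- A single ultrafilter gives all three limits at every time, and inequalities pass to them
  -- without a diagonal extraction.
  choose E hE using fun t => exists_tendsto_hyperfilter ((hB t).mono fun n h => h.1)
  choose V hV using fun t => exists_tendsto_hyperfilter ((hB t).mono fun n h => h.2.1)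
  choose F hF using fun t => exists_tendsto_hyperfilter ((hB t).mono fun n h => h.2.2)
  have hτU : Tendsto τ (hyperfilter ℕ) (𝓝 0) := hτ0.mono_left Nat.hyperfilter_le_atTop
  have hEanti : Antitone E := fun s t hst =>
    le_of_tendsto_of_tendsto' (hE t) (hE s) fun n => hΦanti n (hNmono n hst)
  have hVmono : Monotone V := fun s t hst =>
    le_of_tendsto_of_tendsto' (hV s) (hV t) fun n => hSmono n (hNmono n hst)
  have hFmono : Monotone F := fun s t hst =>
    le_of_tendsto_of_tendsto' (hF s) (hF t) fun n => hlmono n (hNmono n hst)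
  have hFV : ∀ s t, s ≤ t → (F t - F s) ^ 2 ≤ (t - s) * (V t - V s) := by
    intro s t hst
    have h1 : Tendsto (fun n => (t - s + τ n) * (S n (N n t) - S n (N n s))) (hyperfilter ℕ)
        (𝓝 ((t - s + 0) * (V t - V s))) := (hτU.const_add (t - s)).mul ((hV t).sub (hV s))
    rw [add_zero] at h1
    refine le_of_tendsto_of_tendsto' (((hF t).sub (hF s)).pow 2) h1 fun n => ?_
    refine (hlS n _ _ (hNmono n hst)).trans ?_
    gcongr
    · linarith [hSmono n (hNmono n hst)]
    · exact ceil_div_sub_mul_le (hτ n) hst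
  have hEV : ∀ s t, s ≤ t → V t - V s ≤ 2 * (E s - E t) := by
    intro s t hst
    refine le_of_tendsto_of_tendsto' ((hV t).sub (hV s)) (((hE s).sub (hE t)).const_mul 2)
      fun n => ?_
    have := hdiss n (hNmono n hst)
    simp only at this
    linarith
  have hd : ∀ s t, 0 ≤ s → s ≤ t → dist (u s) (u t) ≤ F t - F s := by
    intro s t hs hst
    refine le_of_tendsto_of_tendsto' (((hu s hs).dist (hu t (hs.trans hst))).mono_left
      Nat.hyperfilter_le_atTop) ((hF t).sub (hF s)) fun n => ?_
    simp only [hl]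
    rw [← Finset.sum_Ico_eq_sub _ (hNmono n hst)]
    exact dist_le_Ico_sum_dist (w n) (hNmono n hst)
  have hDG := fun n => (hsch n).exists_deGiorgi_interpolation (hτ n) (hbot n) (h₀ n) (hex n)
  choose v Θ hΘanti hΘgrid hv hvs using hDG
  set H : ℕ → ℝ → ℝ≥0∞ := fun n r => ENNReal.ofReal (-2 * deriv (Θ n) r) with hHdef
  have hHmeas : ∀ n, Measurable (H n) := fun n =>
    ((measurable_deriv (Θ n)).const_mul (-2)).ennreal_ofReal
  set Q : ℝ → ℝ≥0∞ := fun r => liminf (fun n => H n r) atTop with hQdef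
  have hQmeas : Measurable Q := .liminf hHmeas
  have hEQ : ∀ s t, 0 ≤ s → s ≤ t →
      ∫⁻ r in Ioo s t, Q r ≤ ENNReal.ofReal (2 * (E s - E t) - (V t - V s)) := by
    intro s t hs hst
    -- `Θ n` is known exactly only at grid times, so `(s, t)` is replaced by its rounded interval.
    -- Every `r` in `(s, t)` lies there once `τ n < r - s`.
    set I : ℕ → Set ℝ := fun n => Ioo ((N n s : ℝ) * τ n) ((N n t : ℝ) * τ n) with hI
    have h1 : ∫⁻ r in Ioo s t, Q r ≤
        ∫⁻ r in Ioo s t, liminf (fun n => (I n).indicator (H n) r) atTop := by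
      refine setLIntegral_mono' measurableSet_Ioo fun r hr => le_of_eq ?_
      apply liminf_congr
      filter_upwards [hτ0.eventually_lt_const (show 0 < r - s by linarith [hr.1])] with n hn
      rw [indicator_of_mem]
      exact ⟨by linarith [ceil_div_mul_le (hτ n) hs],
        hr.2.trans_le (le_ceil_div_mul (hτ n) t)⟩
    have h2 : ∀ n, ∫⁻ r in Ioo s t, (I n).indicator (H n) r ≤ ENNReal.ofReal
        (2 * (Φ n (N n s) - Φ n (N n t)) - (S n (N n t) - S n (N n s))) := by
      intro n
      calc _ ≤ ∫⁻ r, (I n).indicator (H n) r := setLIntegral_le_lintegral _ _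
        _ = ∫⁻ r in I n, H n r := lintegral_indicator measurableSet_Ioo _
        _ ≤ _ := by
          have hm : Monotone fun r => -2 * Θ n r := fun x y hxy => by
            have := hΘanti n hxy
            simp only
            linarith
          have h3 := hm.lintegral_deriv_le (s := (N n s : ℝ) * τ n) (t := (N n t : ℝ) * τ n)
            (by
              have := hτ n
              have : (N n s : ℝ) ≤ N n t := by exact_mod_cast hNmono n hst
              gcongr)
          simp only [deriv_const_mul_field'] at h3
          refine h3.trans (ENNReal.ofReal_le_ofReal (le_of_eq ?_))
          rw [hΘgrid, hΘgrid]
          simp only [hΦ, hS]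
          ring
    have h4 : Tendsto (fun n => ENNReal.ofReal
        (2 * (Φ n (N n s) - Φ n (N n t)) - (S n (N n t) - S n (N n s)))) (hyperfilter ℕ)
        (𝓝 (ENNReal.ofReal (2 * (E s - E t) - (V t - V s)))) :=
      ENNReal.tendsto_ofReal ((((hE s).sub (hE t)).const_mul 2).sub ((hV t).sub (hV s)))
    calc _ ≤ _ := h1
      _ ≤ liminf (fun n => ∫⁻ r in Ioo s t, (I n).indicator (H n) r) atTop :=
        lintegral_liminf_le fun n => (hHmeas n).indicator measurableSet_Ioo
      _ ≤ liminf (fun n => ENNReal.ofReal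
          (2 * (Φ n (N n s) - Φ n (N n t)) - (S n (N n t) - S n (N n s)))) atTop :=
        liminf_le_liminf (Eventually.of_forall h2)
      _ ≤ liminf (fun n => ENNReal.ofReal (2 * (Φ n (N n s) - Φ n (N n t)) -
          (S n (N n t) - S n (N n s)))) (hyperfilter ℕ) :=
        liminf_le_liminf_of_le Nat.hyperfilter_le_atTop
      _ = _ := h4.liminf_eq
  -- At rational times `E` is the limit of the full sequence. This is needed because the subsequence
  -- realizing the liminf `Q t` depends on `t` and need not belong to the ultrafilter.
  have hErat : ∀ q : ℚ, Tendsto (fun n => Φ n (N n q)) atTop (𝓝 (E q)) := by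
    intro q
    obtain ⟨a, ha⟩ := hconv q
    have h1 : Tendsto (fun n => ((Φ n (N n q) : ℝ) : EReal)) atTop (𝓝 a) := by
      simp only [hΦcoe]
      exact ha
    have h2 := (continuous_coe_real_ereal.tendsto _).comp (hE q)
    have h3 := tendsto_nhds_unique (h1.mono_left Nat.hyperfilter_le_atTop) h2
    rw [h3] at h1
    exact EReal.tendsto_coe.1 h1
  have hlimit : ∀ᵐ t ∂(volume.restrict (Ioo 0 T)),
      φ (u t) = (E t : EReal) ∧ descendingSlope φ (u t) ^ 2 ≤ Q t := by
    have hEd : ∀ᵐ t, ContinuousAt E t := hEanti.ae_differentiableAt.mono fun t ht => ht.continuousAt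
    have hQfin : ∀ᵐ t ∂(volume.restrict (Ioo 0 T)), Q t < ⊤ :=
      ae_lt_top hQmeas ((hEQ 0 T le_rfl hT.le).trans_lt ENNReal.ofReal_lt_top).ne
    filter_upwards [ae_restrict_of_ae hEd, hQfin, ae_restrict_of_ae (ae_all_iff.2 hvs),
      ae_restrict_mem measurableSet_Ioo] with t hEt hQt hst ht
    have ht0 : 0 < t := ht.1
    have hNpos : ∀ n, 0 < N n t := fun n => by
      have := hτ n
      exact Nat.ceil_pos.2 (by positivity)
    have hvu : Tendsto (fun n => v n t) atTop (𝓝 (u t)) := by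
      -- The step around `t` has squared length at most `τ n` times the action, and the interpolant
      -- is at most two such steps away from `w n (N n t)`.
      have h1 : Tendsto (fun n => 2 * √(τ n * B t)) atTop (𝓝 0) := by
        have : Continuous fun x : ℝ => 2 * √(x * B t) := by fun_prop
        simpa [Function.comp_def] using (this.tendsto 0).comp hτ0
      refine tendsto_of_tendsto_of_dist (hu t ht0.le) ?_
      refine squeeze_zero' (Eventually.of_forall fun _ => dist_nonneg) ?_ h1
      filter_upwards [hB t] with n hn
      set k := N n t - 1 with hk
      have hk1 : N n t = k + 1 := by have := hNpos n; omega
      have h2 : dist (w n k) (w n (k + 1)) ^ 2 ≤ τ n * B t := by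
        have h3 : dist (w n k) (w n (k + 1)) ^ 2 / τ n ≤ S n (k + 1) := by
          simp only [hS]
          exact Finset.single_le_sum
            (f := fun j => dist (w n j) (w n (j + 1)) ^ 2 / τ n)
            (fun j _ => by have := hτ n; positivity) (Finset.self_mem_range_succ k)
        rw [← hk1] at h3
        have h4 := (h3.trans (le_abs_self _)).trans hn.2.1
        rw [div_le_iff₀ (hτ n)] at h4
        rw [← hk1]
        linarith
      have h5 := Real.le_sqrt_of_sq_le h2
      have h6 : dist (v n t) (w n k) ≤ dist (w n (N n t)) (w n k) := (hv n t ht0).1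
      rw [hk1, dist_comm (w n (k + 1))] at h6
      change dist (w n (N n t)) (v n t) ≤ _
      rw [hk1]
      have h7 := dist_triangle (w n (k + 1)) (w n k) (v n t)
      rw [dist_comm (w n (k + 1)) (w n k), dist_comm (w n k) (v n t)] at h7
      linarith
    have hvlow : ∀ n, ψ n (w n (N n t)) ≤ ψ n (v n t) := fun n => (hv n t ht0).2.1
    have hvupp : ∀ n, ψ n (v n t) ≤ ψ n (w n (N n t - 1)) := fun n => (hv n t ht0).2.2
    have hvE : Tendsto (fun n => ψ n (v n t)) atTop (𝓝 (E t : EReal)) := by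
      have hcoe : ∀ n, (((ψ n (v n t)).toReal : ℝ) : EReal) = ψ n (v n t) := fun n =>
        EReal.coe_toReal ((hvupp n).trans_lt (lt_top_iff_ne_top.2 (hnt n _))).ne (hbot n _)
      suffices h : Tendsto (fun n => (ψ n (v n t)).toReal) atTop (𝓝 (E t)) by
        have := (continuous_coe_real_ereal.tendsto _).comp h
        refine this.congr fun n => hcoe n
      -- The interpolant's energy lies between those at the ends of its step. Comparing with
      -- rationals on either side of `t`, a continuity point of `E`, squeezes it to `E t`; on the
      -- left, `τ n ≤ t - q` absorbs the one-step shift.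
      refine tendsto_order.2 ⟨fun a ha => ?_, fun a ha => ?_⟩
      · obtain ⟨b, hb, hb'⟩ := (mem_nhdsGT_iff_exists_Ioo_subset).1
          (mem_nhdsWithin_of_mem_nhds (hEt.eventually (lt_mem_nhds ha)))
        obtain ⟨q, hq1, hq2⟩ := exists_rat_btwn (show t < b from hb)
        filter_upwards [(hErat q).eventually (lt_mem_nhds (hb' ⟨hq1, hq2⟩))] with n hn
        refine hn.trans_le ?_
        rw [← EReal.coe_le_coe_iff, hcoe, hΦcoe]
        exact ((hsch n).antitone (hτ n) (hNmono n hq1.le)).trans (hvlow n)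
      · obtain ⟨b, hb, hb'⟩ := (mem_nhdsLT_iff_exists_Ioo_subset).1
          (mem_nhdsWithin_of_mem_nhds (hEt.eventually (gt_mem_nhds ha)))
        obtain ⟨q, hq1, hq2⟩ := exists_rat_btwn (show max b 0 < t from max_lt hb ht0)
        have hq0 : (0 : ℝ) ≤ q := (le_max_right b 0).trans hq1.le
        filter_upwards [(hErat q).eventually (gt_mem_nhds
          (hb' ⟨(le_max_left b 0).trans_lt hq1, hq2⟩)),
          hτ0.eventually_le_const (sub_pos.2 hq2)] with n hn hn'
        refine lt_of_le_of_lt ?_ hn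
        rw [← EReal.coe_le_coe_iff, hcoe, hΦcoe]
        refine (hvupp n).trans ((hsch n).antitone (hτ n) ?_)
        have h1 : N n q + 1 ≤ N n t := by
          simp only [hN]
          rw [← Nat.ceil_add_one (div_nonneg hq0 (hτ n).le)]
          apply Nat.ceil_mono
          rw [← div_self (hτ n).ne', ← add_div]
          have := hτ n
          gcongr
          linarith
        omega
    have hbd : ∀ᶠ n in atTop, (ψ n (v n t)).abs ≤ ENNReal.ofReal (|E t| + 1) := by
      have h1 : ∀ᶠ x in 𝓝 (E t : EReal), x.abs ≤ ENNReal.ofReal (|E t| + 1) := by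
        have h2 : Ioo ((E t - 1 : ℝ) : EReal) ((E t + 1 : ℝ) : EReal) ∈ 𝓝 (E t : EReal) :=
          Ioo_mem_nhds (EReal.coe_lt_coe_iff.2 (by linarith)) (EReal.coe_lt_coe_iff.2 (by linarith))
        filter_upwards [h2] with x hx
        lift x to ℝ using ⟨(hx.2.trans (EReal.coe_lt_top _)).ne,
          ((EReal.bot_lt_coe _).trans hx.1).ne'⟩
        rw [EReal.abs_def]
        apply ENNReal.ofReal_le_ofReal
        have h3 := EReal.coe_lt_coe_iff.1 hx.1
        have h4 := EReal.coe_lt_coe_iff.1 hx.2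
        rw [abs_le]
        constructor
        · linarith [neg_abs_le (E t)]
        · linarith [le_abs_self (E t)]
      exact hvE.eventually h1
    -- Along a subsequence the squared slopes stay below `c`, so (H) applies; `c` then decreases to
    -- `Q t`.
    have key : ∀ c, Q t < c → c ≠ ⊤ →
        φ (u t) = (E t : EReal) ∧ descendingSlope φ (u t) ^ 2 ≤ c := by
      intro c hc hct
      obtain ⟨k, hk, hkp⟩ := extraction_of_frequently_atTop
        ((frequently_lt_of_liminf_lt (by isBoundedDefault) hc).and_eventually hbd)
      have hsq : (c ^ (1 / 2 : ℝ)) ^ 2 = c := by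
        rw [← ENNReal.rpow_natCast, ← ENNReal.rpow_mul]
        norm_num
      have hsl : ∀ n, descendingSlope (ψ (k n)) (v (k n) t) ≤ c ^ (1 / 2 : ℝ) := by
        intro n
        by_contra hlt
        have h1 := ENNReal.pow_lt_pow_left two_ne_zero (not_le.1 hlt)
        rw [hsq] at h1
        exact absurd ((hst (k n) ht0).trans (hkp n).1.le) (not_le.2 h1)
      obtain ⟨h1, h2⟩ := hH k (fun n => v (k n) t) (u t) hk (hvu.comp hk.tendsto_atTop)
        (by
          refine (iSup_le fun n => add_le_add (hkp n).2 (hsl n)).trans_lt ?_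
          exact ENNReal.add_lt_top.2 ⟨ENNReal.ofReal_lt_top,
            ENNReal.rpow_lt_top_of_nonneg (by norm_num) hct⟩)
      refine ⟨tendsto_nhds_unique h1 (hvE.comp hk.tendsto_atTop), ?_⟩
      rw [← hsq]
      gcongr
      refine h2.trans (liminf_le_of_frequently_le' (Frequently.of_forall hsl))
    refine ⟨(key (Q t + 1) (ENNReal.lt_add_right hQt.ne one_ne_zero) (by simp [hQt.ne])).1, ?_⟩
    refine le_of_forall_gt_imp_ge_of_dense fun c hc => ?_
    by_cases hct : c = ⊤
    · simp [hct]
    · exact (key c hc hct).2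
  exact isCurveOfMaximalSlope_of_dissipation hT hEanti hFmono hVmono hQmeas hFV hEV hd hEQ
    (hlimit.mono fun t ht => ht.1) (hlimit.mono fun t ht => ht.2)

end

/-! ### Conclusion: extraction of the subsequence and verification of the hypotheses. -/

theorem theorem1 {X : Type*} [MetricSpace X] [CompleteSpace X]
    (φε : ℝ → X → EReal) (φ : X → EReal)
    (hφε : ∀ ε > 0, ∀ x, φε ε x ≠ ⊥) (hφ : ∀ x, φ x ≠ ⊥)
    (uStar : X)
    (h_i : ∀ ε > 0, LowerSemicontinuous (φε ε))
    (h_ii : ∃ C : ℝ, ∃ τStar > (0 : ℝ), ∀ ε > 0, ∀ v : X,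
      (C : EReal) ≤ φε ε v + ((1 / (2 * τStar) * dist v uStar ^ 2 : ℝ) : EReal))
    (h_iii : ∀ C > (0 : ℝ), ∃ K : Set X, IsCompact K ∧ ∀ ε > 0,
      {u : X | dist u uStar ^ 2 ≤ C ∧ (φε ε u).abs ≤ ENNReal.ofReal C} ⊆ K)
    (h_H : ConditionH φε φ)
    (u₀ : ℝ → ℝ → X)
    (h_u₀ : ∃ S' S : ℝ, ∀ ε > 0, ∀ τ > 0,
      dist (u₀ ε τ) uStar ^ 2 ≤ S' ∧ (φε ε (u₀ ε τ)).abs ≤ ENNReal.ofReal S)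
    (τ : ℝ → ℝ) (hτ_pos : ∀ ε > 0, 0 < τ ε) (hτ_lim : Tendsto τ (𝓝[>] 0) (𝓝 0))
    (u : ℝ → X) (hu : IsMinimizingMovement φε τ (fun ε => u₀ ε (τ ε)) u)
    (T : ℝ) (hT : 0 < T) :
    IsCurveOfMaximalSlope φ T u := by
  obtain ⟨C, τStar, hτStar, hC⟩ := h_ii
  obtain ⟨_, S, hS⟩ := h_u₀
  obtain ⟨w, hw, ε, hε, hε0, hlim⟩ := hu
  have hε' : Tendsto ε atTop (𝓝[>] 0) :=
    tendsto_nhdsWithin_iff.2 ⟨hε0, Eventually.of_forall hε⟩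
  obtain ⟨n₀, hn₀⟩ := eventually_atTop.1 ((hε'.eventually hw).and
    ((hτ_lim.comp hε').eventually_le_const (show 0 < τStar / 4 by positivity)))
  -- The countable product of copies of the compact space `EReal` is sequentially compact, so one
  -- subsequence makes the energies converge at all rational times.
  obtain ⟨a, k, hk, ha⟩ := CompactSpace.tendsto_subseq fun n : ℕ => fun q : ℚ =>
    φε (ε (n + n₀)) (piecewiseConstant (τ (ε (n + n₀))) (w (ε (n + n₀))) q)
  have hκ : StrictMono fun n => k n + n₀ := fun i j hij => Nat.add_lt_add_right (hk hij) n₀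
  set κ : ℕ → ℕ := fun n => k n + n₀
  have hsch : ∀ n, IsDiscreteScheme (φε (ε (κ n))) (τ (ε (κ n))) (u₀ (ε (κ n)) (τ (ε (κ n))))
      (w (ε (κ n))) := fun n => (hn₀ (κ n) (Nat.le_add_left _ _)).1
  -- `max S 0` is used because `ENNReal.ofReal` truncates negative values.
  have hM : ∀ n, φε (ε (κ n)) (u₀ (ε (κ n)) (τ (ε (κ n)))) ≤ ((max S 0 : ℝ) : EReal) := by
    intro n
    have h1 := (hS _ (hε (κ n)) _ (hτ_pos _ (hε (κ n)))).2
    generalize φε (ε (κ n)) (u₀ (ε (κ n)) (τ (ε (κ n)))) = x at h1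
    induction x with
    | bot => exact bot_le
    | top => simp at h1
    | coe x =>
      replace h1 := h1.trans (ENNReal.ofReal_le_ofReal (le_max_left S 0))
      rw [EReal.abs_def, ENNReal.ofReal_le_ofReal_iff (le_max_right _ _)] at h1
      exact EReal.coe_le_coe_iff.2 ((le_abs_self x).trans h1)
  refine isCurveOfMaximalSlope_of_tendsto (ψ := fun n => φε (ε (κ n)))
    (τ := fun n => τ (ε (κ n))) (w := fun n => w (ε (κ n))) hT (fun n => hφε _ (hε _))
    (fun n => hτ_pos _ (hε _)) ((hτ_lim.comp hε').comp hκ.tendsto_atTop) hsch hM hτStar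
    (fun n => hC _ (hε _)) ?_ (fun t ht => (hlim t ht).comp hκ.tendsto_atTop)
    (fun q => ⟨a q, (tendsto_pi_nhds.1 ha) q⟩) ?_
  · intro n i σ hσ hσ'
    refine IsProximal.exists_of_coercive (hφε _ (hε _)) (h_i _ (hε _)) hτStar (hC _ (hε _)) ?_
      ((hsch n).ne_top (hτ_pos _ (hε _)) ((hM n).trans_lt (EReal.coe_lt_top _)).ne i) hσ
      (hσ'.le.trans (hn₀ (κ n) (Nat.le_add_left _ _)).2)
    intro c hc
    obtain ⟨K, hK, hKs⟩ := h_iii c hc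
    exact ⟨K, hK, hKs _ (hε _)⟩
  · intro j v x hj hv hsup
    exact h_H (fun n => ε (κ (j n))) v x (fun n => hε _)
      (hε0.comp (hκ.comp hj).tendsto_atTop) hv hsup
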